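/- **Setting.** Fix a countably infinite, many-sorted set $\mathcal N$ of names in which every occurring sort has infinitely many names. A *permutation* is a sort-preserving bijection $\pi$ of $\mathcal N$ moving only finitely many names. A set $N\subseteq\mathcal N$ *supports* $X$ if $\pi\cdot X=X$ for every permutation $\pi$ fixing $N$ pointwise; a *nominal set* is a set with an action of the group of permutations all of whose elements have a finite support; $\operatorname{supp}(X)$ is the least one, and $N\mathrel\#X$ means $N\cap\operatorname{supp}(X)=\emptyset$. For a finite set $N$ of names, $\langle N\rangle X$ denotes the class of $(N,X)$ under $(N,X)=_\alpha(N',X')$ iff there is a permutation $\pi$ with $\pi\cdot N=N'$, $\pi\cdot X=X'$ and $\pi(a)=a$ for all $a\in\operatorname{supp}(X)\setminus N$. A *nominal transition system* consists of nominal sets of states ($P,Q$), state predicates ($\varphi$) and actions ($\alpha$); an equivariant relation $P\vdash\varphi$; an equivariant map $\operatorname{bn}$ from actions to finite sets of names with $\operatorname{bn}(\alpha)\subseteq\operatorname{supp}(\alpha)$; and an equivariant set of transitions $(P,\langle N\rangle(\alpha,P'))$, each with $N=\operatorname{bn}(\alpha)$. Write $P\xrightarrow{\alpha}P'$ if $(P,\langle\operatorname{bn}(\alpha)\rangle(\alpha,P'))$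 is a transition. Fix an action $\tau$ with empty support. Let $\Rightarrow$ be the reflexive transitive closure of $\xrightarrow{\tau}$; let $P\stackrel{\hat\alpha}{\Rightarrow}P'$ mean $P\Rightarrow P'$ if $\alpha=\tau$, and $P\Rightarrow\circ\xrightarrow{\alpha}\circ\Rightarrow P'$ otherwise. **Weak bisimilarity.** A *weak bisimulation* is a symmetric binary relation $R$ on states such that $R(P,Q)$ implies 1. (weak simulation) whenever $\operatorname{bn}(\alpha)\mathrel\#Q$ and $P\xrightarrow{\alpha}P'$, there is $Q'$ with $Q\stackrel{\hat\alpha}{\Rightarrow}Q'$ and $R(P',Q')$; 2. (weak static implication) whenever $P\vdash\varphi$, there is $Q'$ with $Q\Rightarrow Q'$, $Q'\vdash\varphi$ and $R(P,Q')$. $P\mathrel{\dot\approx}Q$ means that $R(P,Q)$ for some weak bisimulation $R$. **Logic.** Fix a cardinal $\kappa>\aleph_0$ that is larger than the number of states. Formulas are generated inductively by $$A::=\bigwedge_{i\in I}A_i\mid\neg A\mid\varphi\mid\langle\alpha\rangle A,$$ where in a conjunction the set $\{A_i\mid i\in I\}$ has cardinality less than $\kappa$ and finite support, a conjunction depends only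 on this set, permutations distribute over the constructors, and $\langle\alpha\rangle A$ is taken up to alpha-conversion of the names $\operatorname{bn}(\alpha)$, which bind into $\alpha$ and $A$. Validity: $P\models\bigwedge_{i\in I}A_i$ iff $P\models A_i$ for all $i$; $P\models\neg A$ iff not $P\models A$; $P\models\varphi$ iff $P\vdash\varphi$; and $P\models\langle\alpha\rangle A$ iff, for some representative $\langle\beta\rangle B=\langle\alpha\rangle A$ with $\operatorname{bn}(\beta)\mathrel\#P$, there is $P'$ with $P\xrightarrow{\beta}P'$ and $P'\models B$. Put $\bigvee_iA_i=\neg\bigwedge_i\neg A_i$, let $A\wedge B$ be the conjunction of $A$ and $B$, and let $$\langle\langle\tau\rangle\rangle A=\bigvee_{i\in\omega}\langle\tau\rangle^iA,\qquad\langle\langle\alpha\rangle\rangle A=\langle\langle\tau\rangle\rangle\langle\alpha\rangle\langle\langle\tau\rangle\rangle A\quad(\alpha\neq\tau).$$ The *weak formulas* are the formulas generated by $$A::=\bigwedge_{i\in I}A_i\mid\neg A\mid\langle\langle\alpha\rangle\rangle A\mid\langle\langle\tau\rangle\rangle(A\wedge\varphi)$$ (with the same conditions on conjunctions). Write $P\mathrel{\dot\equiv}Q$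 if $P\models A\iff Q\models A$ for every weak formula $A$. **Theorem.** For all states $P,Q$: if $P\mathrel{\dot\equiv}Q$, then $P\mathrel{\dot\approx}Q$. -/

import Mathlib

open Cardinal

universe u v w

/-! ### Names, permutations and nominal sets -/

/-- A countably infinite, many-sorted set of names.  Every sort that occurs has infinitely many
names, so that fresh names are always available. -/
class SortedNames (𝒩 : Type u) where
  /-- the sorts -/
  Srt : Type u
  /-- the sort of a name -/
  sort : 𝒩 → Srt
  countable : Countable 𝒩
  nonempty : Nonempty 𝒩
  infinite_sort : ∀ a : 𝒩, {b : 𝒩 | sort b = sort a}.Infinite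

/-- The group of permutations: sort-preserving bijections on names that leave all but finitely
many names invariant. -/
def namePerm (𝒩 : Type u) [SortedNames 𝒩] : Subgroup (Equiv.Perm 𝒩) where
  carrier := {π | {a | π a ≠ a}.Finite ∧ ∀ a, SortedNames.sort (π a) = SortedNames.sort a}
  one_mem' := by simp
  mul_mem' := by
    rintro π ρ ⟨hπ, hπ'⟩ ⟨hρ, hρ'⟩
    refine ⟨(hπ.union hρ).subset ?_, fun a => ?_⟩
    · intro a ha
      by_contra h
      simp only [Set.mem_union, Set.mem_ofPred_eq, not_or, not_not] at h
      exact ha (by rw [Equiv.Perm.mul_apply, h.2, h.1])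
    · rw [Equiv.Perm.mul_apply, hπ', hρ']
  inv_mem' := by
    rintro π ⟨hπ, hπ'⟩
    refine ⟨hπ.subset ?_, fun a => ?_⟩
    · intro a ha h
      exact ha (by rw [Equiv.Perm.inv_eq_iff_eq, h])
    · have := hπ' (π⁻¹ a)
      rw [show π (π⁻¹ a) = a from π.apply_symm_apply a] at this
      exact this.symm

/-- The name permutations, acting on names by application. -/
abbrev NPerm (𝒩 : Type u) [SortedNames 𝒩] : Type u := namePerm 𝒩

/-- A nominal set: a set with a permutation action all of whose members have finite support.
Here `MulAction.Supports G A x` says that every `π` in `G` leaving all members of `A` invariant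
satisfies `π • x = x`. -/
class Nominal (𝒩 : Type u) [SortedNames 𝒩] (X : Type*) extends MulAction (NPerm 𝒩) X where
  finite_support : ∀ x : X, ∃ A : Set 𝒩, A.Finite ∧ MulAction.Supports (NPerm 𝒩) A x

section Support

variable (𝒩 : Type u) [SortedNames 𝒩] {X : Type*}

/-- The support of `x`: the least finite set of names that supports `x`. -/
def supp [SMul (NPerm 𝒩) X] (x : X) : Set 𝒩 :=
  ⋂₀ {A : Set 𝒩 | A.Finite ∧ MulAction.Supports (NPerm 𝒩) A x}

variable {𝒩}

/-- `B # x`: all names in `B` are fresh for `x`. -/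
def Fresh [SMul (NPerm 𝒩) X] (B : Finset 𝒩) (x : X) : Prop :=
  ∀ a ∈ B, a ∉ supp 𝒩 x

/-- The action of a permutation on a finite set of names. -/
def permNames (π : NPerm 𝒩) (B : Finset 𝒩) : Finset 𝒩 :=
  B.map (π : Equiv.Perm 𝒩).toEmbedding

theorem mem_permNames {π : NPerm 𝒩} {B : Finset 𝒩} {a : 𝒩} :
    a ∈ permNames π B ↔ π⁻¹ • a ∈ B := by
  unfold permNames
  rw [Finset.mem_map_equiv]
  rfl

theorem permNames_one (B : Finset 𝒩) : permNames 1 B = B := by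
  ext a; simp [mem_permNames]

theorem permNames_mul (π ρ : NPerm 𝒩) (B : Finset 𝒩) :
    permNames (π * ρ) B = permNames π (permNames ρ B) := by
  ext a; simp [mem_permNames, mul_smul]

theorem supports_smul [MulAction (NPerm 𝒩) X] {A : Set 𝒩} {x : X}
    (h : MulAction.Supports (NPerm 𝒩) A x) (π : NPerm 𝒩) :
    MulAction.Supports (NPerm 𝒩) ((fun a => π • a) '' A) (π • x) := by
  intro σ hσ
  have h1 : (π⁻¹ * σ * π) • x = x := by
    refine h _ fun a ha => ?_
    have := hσ (Set.mem_image_of_mem _ ha)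
    rw [mul_smul, mul_smul, this, inv_smul_smul]
  rw [mul_smul, mul_smul, inv_smul_eq_iff] at h1
  exact h1

theorem smul_mem_supp [MulAction (NPerm 𝒩) X] {x : X} {a : 𝒩} (π : NPerm 𝒩)
    (h : a ∈ supp 𝒩 x) : π • a ∈ supp 𝒩 (π • x) := by
  rintro A ⟨hA, hs⟩
  have h2 := supports_smul hs π⁻¹
  rw [inv_smul_smul] at h2
  obtain ⟨b, hb, hba⟩ := h _ ⟨hA.image _, h2⟩
  simp only at hba
  rwa [← hba, smul_inv_smul]

theorem mem_supp_smul [MulAction (NPerm 𝒩) X] {x : X} {a : 𝒩} {π : NPerm 𝒩} :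
    a ∈ supp 𝒩 (π • x) ↔ π⁻¹ • a ∈ supp 𝒩 x := by
  constructor
  · intro h
    have := smul_mem_supp π⁻¹ h
    rwa [inv_smul_smul] at this
  · intro h
    have := smul_mem_supp π h
    rwa [smul_inv_smul] at this

/-- Nominal alpha-equivalence of pairs `(B, x)` of a finite set `B` of binding names and an
element `x`. -/
def absSetoid (𝒩 : Type u) [SortedNames 𝒩] (X : Type*) [MulAction (NPerm 𝒩) X] :
    Setoid (Finset 𝒩 × X) where
  r p q := ∃ π : NPerm 𝒩, permNames π p.1 = q.1 ∧ π • p.2 = q.2 ∧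
    ∀ a ∈ supp 𝒩 p.2 \ (p.1 : Set 𝒩), π • a = a
  iseqv := by
    refine ⟨fun p => ⟨1, permNames_one _, one_smul _ _, fun a _ => one_smul _ a⟩, ?_, ?_⟩
    · rintro ⟨B, x⟩ ⟨C, y⟩ ⟨π, h1, h2, h3⟩
      simp only at h1 h2 h3
      subst h1 h2
      refine ⟨π⁻¹, ?_, inv_smul_smul _ _, ?_⟩
      · rw [← permNames_mul, inv_mul_cancel, permNames_one]
      · rintro a ⟨ha, haB⟩
        have h4 := h3 (π⁻¹ • a) ⟨mem_supp_smul.1 ha, fun h => haB (mem_permNames.2 h)⟩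
        rw [smul_inv_smul] at h4
        exact h4.symm
    · rintro ⟨B, x⟩ ⟨C, y⟩ ⟨D, z⟩ ⟨π, h1, h2, h3⟩ ⟨ρ, k1, k2, k3⟩
      simp only at h1 h2 h3 k1 k2 k3
      subst h1 h2 k1 k2
      refine ⟨ρ * π, permNames_mul _ _ _, mul_smul _ _ _, ?_⟩
      rintro a ⟨ha, haB⟩
      have h4 := h3 a ⟨ha, haB⟩
      have h5 : π⁻¹ • a = a := by rw [inv_smul_eq_iff, h4]
      rw [mul_smul, h4]
      refine k3 a ⟨mem_supp_smul.2 (by rwa [h5]), fun h => haB ?_⟩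
      have := mem_permNames.1 h
      rwa [h5] at this

/-- Generalised name abstraction: pairs of a finite set of names and an element of `X`, up to
alpha-equivalence. -/
def NameAbs (𝒩 : Type u) [SortedNames 𝒩] (X : Type*) [MulAction (NPerm 𝒩) X] : Type _ :=
  Quotient (absSetoid 𝒩 X)

/-- The abstraction of the names `B` in `x`. -/
def NameAbs.mk [MulAction (NPerm 𝒩) X] (B : Finset 𝒩) (x : X) : NameAbs 𝒩 X :=
  Quotient.mk (absSetoid 𝒩 X) (B, x)

end Support

/-! ### Nominal transition systems -/

/-- A nominal transition system. -/
structure NTS (𝒩 : Type u) [SortedNames 𝒩] (State Pred Act : Type*)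
    [Nominal 𝒩 State] [Nominal 𝒩 Pred] [Nominal 𝒩 Act] where
  /-- `Sat P φ`: the state predicate `φ` holds in the state `P` -/
  Sat : State → Pred → Prop
  sat_equivariant : ∀ (π : NPerm 𝒩) (P : State) (φ : Pred), Sat P φ → Sat (π • P) (π • φ)
  /-- the binding names of an action -/
  bn : Act → Finset 𝒩
  bn_equivariant : ∀ (π : NPerm 𝒩) (α : Act), bn (π • α) = permNames π (bn α)
  bn_subset : ∀ α : Act, (bn α : Set 𝒩) ⊆ supp 𝒩 α
  /-- the transition relation, between states and residuals -/
  trans : Set (State × NameAbs 𝒩 (Act × State))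
  trans_equivariant : ∀ (π : NPerm 𝒩) (P : State) (B : Finset 𝒩) (α : Act) (Q : State),
    (P, NameAbs.mk B (α, Q)) ∈ trans →
      (π • P, NameAbs.mk (permNames π B) (π • α, π • Q)) ∈ trans
  bn_eq : ∀ (P : State) (B : Finset 𝒩) (α : Act) (Q : State),
    (P, NameAbs.mk B (α, Q)) ∈ trans → bn α = B

section Logic

variable {𝒩 : Type u} [SortedNames 𝒩] {State Pred Act : Type*}
  [Nominal 𝒩 State] [Nominal 𝒩 Pred] [Nominal 𝒩 Act] (T : NTS 𝒩 State Pred Act)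

/-- `T.Step P α P'`: there is a transition from `P` labelled by `α` to `P'`. -/
def NTS.Step (P : State) (α : Act) (P' : State) : Prop :=
  (P, NameAbs.mk (T.bn α) (α, P')) ∈ T.trans

theorem NTS.Step.smul {T : NTS 𝒩 State Pred Act} {P : State} {α : Act} {P' : State}
    (h : T.Step P α P') (π : NPerm 𝒩) : T.Step (π • P) (π • α) (π • P') := by
  have := T.trans_equivariant π _ _ _ _ h
  rwa [← T.bn_equivariant] at this

/-! ### Raw formulas and alpha-equivalence -/

/-- Raw formulas, not yet identified up to alpha-equivalence, whose conjunctions have fewer than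
`κ` conjuncts. -/
inductive Raw (Pred : Type*) (Act : Type*) (κ : Cardinal.{w}) : Type _
  | conj (I : Type w) (hI : #I < κ) (f : I → Raw Pred Act κ) : Raw Pred Act κ
  | neg (R : Raw Pred Act κ) : Raw Pred Act κ
  | pred (φ : Pred) : Raw Pred Act κ
  | act (α : Act) (R : Raw Pred Act κ) : Raw Pred Act κ

variable {κ : Cardinal.{w}}

/-- Name permutation distributes over all constructors. -/
def Raw.perm (π : NPerm 𝒩) : Raw Pred Act κ → Raw Pred Act κ
  | .conj I hI f => .conj I hI fun i => (f i).perm π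
  | .neg R => .neg (R.perm π)
  | .pred φ => .pred (π • φ)
  | .act α R => .act (π • α) (R.perm π)

instance Raw.instMulAction : MulAction (NPerm 𝒩) (Raw Pred Act κ) where
  smul π R := R.perm π
  one_smul R := by
    change Raw.perm 1 R = R
    induction R with
    | conj I hI f ih => simp only [Raw.perm, ih]
    | neg R ih => simp only [Raw.perm, ih]
    | pred φ => simp only [Raw.perm, one_smul]
    | act α R ih => simp only [Raw.perm, ih, one_smul]
  mul_smul π ρ R := by
    change Raw.perm (π * ρ) R = Raw.perm π (Raw.perm ρ R)
    induction R with
    | conj I hI f ih => simp only [Raw.perm, ih]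
    | neg R ih => simp only [Raw.perm, ih]
    | pred φ => simp only [Raw.perm, mul_smul]
    | act α R ih => simp only [Raw.perm, ih, mul_smul]

/-- The intersection of all finite sets `A` of names such that every permutation leaving the
members of `A` invariant satisfies `p`. -/
def suppOf (p : NPerm 𝒩 → Prop) : Set 𝒩 :=
  ⋂₀ {A : Set 𝒩 | A.Finite ∧ ∀ σ : NPerm 𝒩, (∀ a ∈ A, σ • a = a) → p σ}

/-- Alpha-equivalence of raw formulas.  Conjunctions are compared as sets of conjuncts.  In the
last case, `suppOf fun σ => AlphaEq R (σ • R)` is the support of the alpha-equivalence class of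
`R`, and `AlphaEq R (π⁻¹ • S)` says that `π • R` and `S` are alpha-equivalent. -/
def NTS.AlphaEq : Raw Pred Act κ → Raw Pred Act κ → Prop
  | .conj _ _ f, .conj _ _ g =>
      (∀ i, ∃ j, NTS.AlphaEq (f i) (g j)) ∧ (∀ j, ∃ i, NTS.AlphaEq (f i) (g j))
  | .neg R, .neg S => NTS.AlphaEq R S
  | .pred φ, .pred ψ => φ = ψ
  | .act α R, .act β S => ∃ π : NPerm 𝒩, π • α = β ∧ NTS.AlphaEq R (π⁻¹ • S) ∧
      ∀ a ∈ (supp 𝒩 α ∪ suppOf fun σ => NTS.AlphaEq R (σ • R)) \ (T.bn α : Set 𝒩), π • a = a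
  | _, _ => False

/-- The support of the alpha-equivalence class of a raw formula. -/
def NTS.rsupp (R : Raw Pred Act κ) : Set 𝒩 := suppOf fun σ => T.AlphaEq R (σ • R)

/-- The alpha-equivalence class of the raw formula `R` has finite support. -/
def NTS.RawFinSupp (R : Raw Pred Act κ) : Prop :=
  ∃ A : Set 𝒩, A.Finite ∧ ∀ σ : NPerm 𝒩, (∀ a ∈ A, σ • a = a) → T.AlphaEq R (σ • R)

theorem Raw.smul_conj (π : NPerm 𝒩) {I : Type w} (hI : #I < κ) (f : I → Raw Pred Act κ) :
    π • Raw.conj I hI f = Raw.conj I hI fun i => π • f i := rfl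
theorem Raw.smul_neg (π : NPerm 𝒩) (R : Raw Pred Act κ) : π • Raw.neg R = Raw.neg (π • R) := rfl
theorem Raw.smul_pred (π : NPerm 𝒩) (φ : Pred) :
    π • (Raw.pred φ : Raw Pred Act κ) = Raw.pred (π • φ) := rfl
theorem Raw.smul_act (π : NPerm 𝒩) (α : Act) (R : Raw Pred Act κ) :
    π • Raw.act α R = Raw.act (π • α) (π • R) := rfl

theorem NTS.alphaEq_act {α β : Act} {R S : Raw Pred Act κ} :
    T.AlphaEq (Raw.act α R) (Raw.act β S) ↔ ∃ π : NPerm 𝒩, π • α = β ∧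
      T.AlphaEq R (π⁻¹ • S) ∧ ∀ a ∈ (supp 𝒩 α ∪ T.rsupp R) \ (T.bn α : Set 𝒩), π • a = a :=
  Iff.rfl

theorem NTS.alphaEq_refl (R : Raw Pred Act κ) : T.AlphaEq R R := by
  induction R with
  | conj I hI f ih => exact ⟨fun i => ⟨i, ih i⟩, fun i => ⟨i, ih i⟩⟩
  | neg R ih => exact ih
  | pred φ => exact rfl
  | act α R ih =>
    exact ⟨1, one_smul _ _, by rwa [inv_one, one_smul], fun a _ => one_smul _ a⟩

theorem NTS.mem_rsupp_smul_of {R : Raw Pred Act κ}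
    (h : ∀ (S : Raw Pred Act κ) (ρ : NPerm 𝒩), T.AlphaEq R S → T.AlphaEq (ρ • R) (ρ • S))
    {ρ : NPerm 𝒩} {a : 𝒩} (ha : a ∈ T.rsupp (ρ • R)) : ρ⁻¹ • a ∈ T.rsupp R := by
  rintro A ⟨hA, hs⟩
  obtain ⟨b, hb, hba⟩ := ha ((fun a => ρ • a) '' A) ⟨hA.image _, fun σ hσ => by
    have h1 : T.AlphaEq R ((ρ⁻¹ * σ * ρ) • R) := by
      refine hs _ fun b hb => ?_
      have := hσ _ (Set.mem_image_of_mem _ hb)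
      rw [mul_smul, mul_smul, this, inv_smul_smul]
    have h2 := h _ ρ h1
    rwa [mul_smul, mul_smul, smul_inv_smul] at h2⟩
  simp only at hba
  rwa [← hba, inv_smul_smul]

theorem NTS.mem_bn_smul {ρ : NPerm 𝒩} {α : Act} {a : 𝒩} :
    a ∈ T.bn (ρ • α) ↔ ρ⁻¹ • a ∈ T.bn α := by
  rw [T.bn_equivariant, mem_permNames]

theorem NTS.alphaEq_smul {R S : Raw Pred Act κ} (h : T.AlphaEq R S) (ρ : NPerm 𝒩) :
    T.AlphaEq (ρ • R) (ρ • S) := by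
  induction R generalizing S ρ with
  | conj I hI f ih =>
    cases S with
    | conj J hJ g =>
      exact ⟨fun i => (h.1 i).imp fun j hj => ih i hj ρ, fun j => (h.2 j).imp fun i hi => ih i hi ρ⟩
    | _ => exact h.elim
  | neg R ih =>
    cases S with
    | neg S => exact ih (S := S) h ρ
    | _ => exact h.elim
  | pred φ =>
    cases S with
    | pred ψ => exact congrArg (ρ • ·) (show φ = ψ from h)
    | _ => exact h.elim
  | act α R ih =>
    cases S with
    | act β S =>
      obtain ⟨π, h1, h2, h3⟩ := T.alphaEq_act.1 h
      refine T.alphaEq_act.2 ⟨ρ * π * ρ⁻¹, ?_, ?_, ?_⟩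
      · rw [mul_smul, mul_smul, inv_smul_smul, h1]
      · have := ih h2 ρ
        change T.AlphaEq (ρ • R) ((ρ * π * ρ⁻¹)⁻¹ • ρ • S)
        rwa [mul_inv_rev, mul_inv_rev, inv_inv, mul_smul, mul_smul, inv_smul_smul]
      · rintro a ⟨ha, hab⟩
        have := h3 (ρ⁻¹ • a) ⟨ha.imp mem_supp_smul.1
          (T.mem_rsupp_smul_of fun S ρ h => ih h ρ), fun h => hab (T.mem_bn_smul.2 h)⟩
        rw [mul_smul, mul_smul, this, smul_inv_smul]
    | _ => exact h.elim

theorem NTS.mem_rsupp_smul {R : Raw Pred Act κ} {ρ : NPerm 𝒩} {a : 𝒩} :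
    a ∈ T.rsupp (ρ • R) ↔ ρ⁻¹ • a ∈ T.rsupp R := by
  refine ⟨T.mem_rsupp_smul_of fun S ρ h => T.alphaEq_smul h ρ, fun h => ?_⟩
  have h1 : ρ⁻¹ • a ∈ T.rsupp (ρ⁻¹ • ρ • R) := by rwa [inv_smul_smul]
  have h2 := T.mem_rsupp_smul_of (fun S ρ h => T.alphaEq_smul h ρ) h1
  rwa [inv_inv, smul_inv_smul] at h2

theorem NTS.alphaEq_aux (R : Raw Pred Act κ) :
    (∀ S U : Raw Pred Act κ, T.AlphaEq R S → T.AlphaEq R U → T.AlphaEq S U) ∧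
    (∀ S U : Raw Pred Act κ, T.AlphaEq R S → T.AlphaEq S U → T.AlphaEq R U) := by
  induction R with
  | conj I hI f ih =>
    refine ⟨fun S U hS hU => ?_, fun S U hS hU => ?_⟩
    · cases S with
      | conj J hJ g =>
        cases U with
        | conj K hK k =>
          refine ⟨fun j => ?_, fun j => ?_⟩
          · obtain ⟨i, hi⟩ := hS.2 j
            obtain ⟨l, hl⟩ := hU.1 i
            exact ⟨l, (ih i).1 _ _ hi hl⟩
          · obtain ⟨i, hi⟩ := hU.2 j
            obtain ⟨l, hl⟩ := hS.1 i
            exact ⟨l, (ih i).1 _ _ hl hi⟩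
        | _ => exact hU.elim
      | _ => exact hS.elim
    · cases S with
      | conj J hJ g =>
        cases U with
        | conj K hK k =>
          refine ⟨fun i => ?_, fun j => ?_⟩
          · obtain ⟨j, hj⟩ := hS.1 i
            obtain ⟨l, hl⟩ := hU.1 j
            exact ⟨l, (ih i).2 _ _ hj hl⟩
          · obtain ⟨l, hl⟩ := hU.2 j
            obtain ⟨i, hi⟩ := hS.2 l
            exact ⟨i, (ih i).2 _ _ hi hl⟩
        | _ => exact hU.elim
      | _ => exact hS.elim
  | neg R ih =>
    refine ⟨fun S U hS hU => ?_, fun S U hS hU => ?_⟩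
    · cases S with
      | neg S =>
        cases U with
        | neg U => exact ih.1 S U hS hU
        | _ => exact hU.elim
      | _ => exact hS.elim
    · cases S with
      | neg S =>
        cases U with
        | neg U => exact ih.2 S U hS hU
        | _ => exact hU.elim
      | _ => exact hS.elim
  | pred φ =>
    refine ⟨fun S U hS hU => ?_, fun S U hS hU => ?_⟩
    · cases S with
      | pred ψ =>
        cases U with
        | pred χ => exact (show φ = ψ from hS).symm.trans (show φ = χ from hU)
        | _ => exact hU.elim
      | _ => exact hS.elim
    · cases S with
      | pred ψ =>
        cases U with
        | pred χ => exact (show φ = ψ from hS).trans (show ψ = χ from hU)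
        | _ => exact hU.elim
      | _ => exact hS.elim
  | act α R ih =>
    have symm : ∀ S, T.AlphaEq R S → T.AlphaEq S R := fun S h => ih.1 _ _ h (T.alphaEq_refl R)
    have supp_eq : ∀ S, T.AlphaEq R S → T.rsupp R = T.rsupp S := by
      intro S h
      unfold NTS.rsupp
      congr 1
      funext σ
      refine propext ⟨fun k => ?_, fun k => ?_⟩
      · exact ih.1 _ _ h (ih.2 _ _ k (T.alphaEq_smul h σ))
      · refine ih.2 _ _ (ih.2 _ _ h k) (T.alphaEq_smul (symm S h) σ)
    have free : ∀ (π : NPerm 𝒩) (S : Raw Pred Act κ), T.AlphaEq R (π⁻¹ • S) → ∀ a : 𝒩,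
        a ∈ (supp 𝒩 (π • α) ∪ T.rsupp S) \ (T.bn (π • α) : Set 𝒩) ↔
        π⁻¹ • a ∈ (supp 𝒩 α ∪ T.rsupp R) \ (T.bn α : Set 𝒩) := by
      intro π S h a
      rw [supp_eq _ h]
      simp only [Set.mem_sdiff, Set.mem_union, mem_supp_smul, Finset.mem_coe, T.mem_bn_smul,
        T.mem_rsupp_smul, inv_inv, smul_inv_smul]
    refine ⟨fun S U hS hU => ?_, fun S U hS hU => ?_⟩
    · cases S with
      | act β S =>
        cases U with
        | act γ U =>
          obtain ⟨π, rfl, h2, h3⟩ := T.alphaEq_act.1 hS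
          obtain ⟨ρ, rfl, k2, k3⟩ := T.alphaEq_act.1 hU
          refine T.alphaEq_act.2 ⟨ρ * π⁻¹, ?_, ?_, ?_⟩
          · rw [mul_smul, inv_smul_smul]
          · have := T.alphaEq_smul (ih.1 _ _ h2 k2) π
            rwa [mul_inv_rev, inv_inv, mul_smul, ← smul_inv_smul π S]
          · intro a ha
            have ha' := (free π S h2 a).1 ha
            have h4 := h3 _ ha'
            rw [mul_smul, k3 _ ha', ← h4, smul_inv_smul]
            
        | _ => exact hU.elim
      | _ => exact hS.elim
    · cases S with
      | act β S =>
        cases U with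
        | act γ U =>
          obtain ⟨π, rfl, h2, h3⟩ := T.alphaEq_act.1 hS
          obtain ⟨ρ, rfl, k2, k3⟩ := T.alphaEq_act.1 hU
          refine T.alphaEq_act.2 ⟨ρ * π, mul_smul _ _ _, ?_, ?_⟩
          · rw [mul_inv_rev, mul_smul]
            exact ih.2 _ _ h2 (T.alphaEq_smul k2 _)
          · intro a ha
            have h4 := h3 a ha
            rw [mul_smul, h4]
            refine k3 a ((free π S h2 a).2 ?_)
            rwa [show π⁻¹ • a = a by rw [inv_smul_eq_iff, h4]]
        | _ => exact hU.elim
      | _ => exact hS.elim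

/-- Alpha-equivalence of raw formulas as an equivalence relation. -/
def NTS.rawSetoid (κ : Cardinal.{w}) : Setoid (Raw Pred Act κ) where
  r := T.AlphaEq
  iseqv := ⟨T.alphaEq_refl, fun h => (T.alphaEq_aux _).1 _ _ h (T.alphaEq_refl _),
    fun h k => (T.alphaEq_aux _).2 _ _ h k⟩

theorem NTS.alphaEq_symm {R S : Raw Pred Act κ} (h : T.AlphaEq R S) : T.AlphaEq S R :=
  (T.rawSetoid κ).symm h

theorem NTS.alphaEq_trans {R S U : Raw Pred Act κ} (h : T.AlphaEq R S) (k : T.AlphaEq S U) :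
    T.AlphaEq R U :=
  (T.rawSetoid κ).trans h k

theorem NTS.rsupp_congr {R S : Raw Pred Act κ} (h : T.AlphaEq R S) : T.rsupp R = T.rsupp S := by
  unfold NTS.rsupp
  congr 1
  funext σ
  refine propext ⟨fun k => ?_, fun k => ?_⟩
  · exact T.alphaEq_trans (T.alphaEq_symm h) (T.alphaEq_trans k (T.alphaEq_smul h σ))
  · exact T.alphaEq_trans h (T.alphaEq_trans k (T.alphaEq_symm (T.alphaEq_smul h σ)))

/-- The raw formula `R` is hereditarily finitely supported: the alpha-equivalence class of each
of its subformulas has finite support. -/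
def NTS.HFS : Raw Pred Act κ → Prop
  | .conj I hI f => T.RawFinSupp (.conj I hI f) ∧ ∀ i, NTS.HFS (f i)
  | .neg R => T.RawFinSupp (.neg R) ∧ NTS.HFS R
  | .pred φ => T.RawFinSupp (.pred φ : Raw Pred Act κ)
  | .act α R => T.RawFinSupp (.act α R) ∧ NTS.HFS R

theorem NTS.HFS.finSupp {T : NTS 𝒩 State Pred Act} {R : Raw Pred Act κ} (h : T.HFS R) :
    T.RawFinSupp R := by
  cases R with
  | pred φ => exact h
  | _ => exact h.1

theorem NTS.RawFinSupp.smul {T : NTS 𝒩 State Pred Act} {R : Raw Pred Act κ} (h : T.RawFinSupp R)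
    (ρ : NPerm 𝒩) : T.RawFinSupp (ρ • R) := by
  obtain ⟨A, hA, hs⟩ := h
  refine ⟨(fun a => ρ • a) '' A, hA.image _, fun σ hσ => ?_⟩
  have h1 : T.AlphaEq R ((ρ⁻¹ * σ * ρ) • R) := by
    refine hs _ fun b hb => ?_
    have := hσ _ (Set.mem_image_of_mem _ hb)
    rw [mul_smul, mul_smul, this, inv_smul_smul]
  have h2 := T.alphaEq_smul h1 ρ
  rwa [mul_smul, mul_smul, smul_inv_smul] at h2

theorem NTS.HFS.smul {T : NTS 𝒩 State Pred Act} {R : Raw Pred Act κ} (h : T.HFS R)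
    (ρ : NPerm 𝒩) : T.HFS (ρ • R) := by
  induction R with
  | conj I hI f ih => exact ⟨h.1.smul ρ, fun i => ih i (h.2 i)⟩
  | neg R ih => exact ⟨h.1.smul ρ, ih h.2⟩
  | pred φ => exact NTS.RawFinSupp.smul h ρ
  | act α R ih => exact ⟨h.1.smul ρ, ih h.2⟩

/-! ### Formulas -/

/-- Formulas: the hereditarily finitely supported alpha-equivalence classes of raw formulas. -/
def NTS.Formula (κ : Cardinal.{w}) : Type _ :=
  {A : Quotient (T.rawSetoid κ) // ∃ R, T.HFS R ∧ Quotient.mk _ R = A}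

variable {T}

/-- The formula represented by a raw formula. -/
def NTS.Formula.mk (R : Raw Pred Act κ) (h : T.HFS R) : T.Formula κ :=
  ⟨Quotient.mk _ R, R, h, rfl⟩

/-- A raw formula that represents the given formula. -/
noncomputable def NTS.Formula.rep (A : T.Formula κ) : Raw Pred Act κ := A.2.choose

theorem NTS.Formula.rep_hfs (A : T.Formula κ) : T.HFS A.rep := A.2.choose_spec.1

theorem NTS.Formula.mk_rep (A : T.Formula κ) : NTS.Formula.mk A.rep A.rep_hfs = A :=
  Subtype.ext A.2.choose_spec.2

theorem NTS.Formula.mk_eq_mk {R S : Raw Pred Act κ} {hR : T.HFS R} {hS : T.HFS S} :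
    NTS.Formula.mk R hR = NTS.Formula.mk S hS ↔ T.AlphaEq R S := by
  exact Subtype.ext_iff.trans (Quotient.eq (r := T.rawSetoid κ))

theorem NTS.Formula.rep_mk {R : Raw Pred Act κ} (h : T.HFS R) :
    T.AlphaEq (NTS.Formula.mk R h).rep R :=
  NTS.Formula.mk_eq_mk.1 (NTS.Formula.mk_rep _)

/-- The permutation action on formulas, inherited from raw formulas. -/
noncomputable instance NTS.Formula.instSMul : SMul (NPerm 𝒩) (T.Formula κ) where
  smul π A := NTS.Formula.mk (π • A.rep) (A.rep_hfs.smul π)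

theorem NTS.Formula.smul_mk (π : NPerm 𝒩) (R : Raw Pred Act κ) (h : T.HFS R) :
    π • NTS.Formula.mk R h = NTS.Formula.mk (π • R) (h.smul π) :=
  NTS.Formula.mk_eq_mk.2 (T.alphaEq_smul (NTS.Formula.rep_mk h) π)

/-- Formulas form a nominal set. -/
noncomputable instance NTS.Formula.instNominal : Nominal 𝒩 (T.Formula κ) where
  one_smul A := by
    rw [← A.mk_rep, NTS.Formula.smul_mk, NTS.Formula.mk_eq_mk, one_smul]
    exact T.alphaEq_refl _
  mul_smul π ρ A := by
    rw [← A.mk_rep, NTS.Formula.smul_mk, NTS.Formula.smul_mk, NTS.Formula.smul_mk,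
      NTS.Formula.mk_eq_mk, mul_smul]
    exact T.alphaEq_refl _
  finite_support A := by
    obtain ⟨N, hN, hs⟩ := A.rep_hfs.finSupp
    refine ⟨N, hN, fun σ hσ => ?_⟩
    rw [← A.mk_rep, NTS.Formula.smul_mk, NTS.Formula.mk_eq_mk]
    exact T.alphaEq_symm (hs σ fun a ha => hσ ha)

/-- The set `{A i | i ∈ I}` of formulas has finite support. -/
def FinSuppFamily {I : Type w} (A : I → T.Formula κ) : Prop :=
  ∃ N : Set 𝒩, N.Finite ∧ ∀ σ : NPerm 𝒩, (∀ a ∈ N, σ • a = a) →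
    (fun B => σ • B) '' Set.range A = Set.range A

/-- The conjunction of a finitely supported set of formulas of cardinality less than `κ`. -/
noncomputable def NTS.Formula.conj (I : Type w) (hI : #I < κ) (A : I → T.Formula κ)
    (hA : FinSuppFamily A) : T.Formula κ :=
  NTS.Formula.mk (Raw.conj I hI fun i => (A i).rep) (by
    refine ⟨?_, fun i => (A i).rep_hfs⟩
    obtain ⟨N, hN, hs⟩ := hA
    refine ⟨N, hN, fun σ hσ => ?_⟩
    have h := hs σ fun a ha => hσ a ha
    refine ⟨fun i => ?_, fun j => ?_⟩
    · have hi : A i ∈ (fun B => σ • B) '' Set.range A := by rw [h]; exact ⟨i, rfl⟩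
      obtain ⟨_, ⟨j, rfl⟩, hj⟩ := hi
      refine ⟨j, T.alphaEq_symm ?_⟩
      simp only at hj
      rw [← (A j).mk_rep, NTS.Formula.smul_mk, ← (A i).mk_rep, NTS.Formula.mk_eq_mk] at hj
      exact hj
    · have hj : σ • A j ∈ Set.range A := by rw [← h]; exact ⟨A j, ⟨j, rfl⟩, rfl⟩
      obtain ⟨i, hi⟩ := hj
      refine ⟨i, ?_⟩
      rw [← (A j).mk_rep, NTS.Formula.smul_mk, ← (A i).mk_rep, NTS.Formula.mk_eq_mk] at hi
      exact hi)

/-- Negation. -/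
noncomputable def NTS.Formula.neg (A : T.Formula κ) : T.Formula κ :=
  NTS.Formula.mk (Raw.neg A.rep)
    ⟨A.rep_hfs.finSupp.imp fun _ h => ⟨h.1, fun σ hσ => h.2 σ hσ⟩, A.rep_hfs⟩

/-- State predicates as formulas. -/
noncomputable def NTS.Formula.pred (φ : Pred) : T.Formula κ :=
  NTS.Formula.mk (Raw.pred φ) (by
    obtain ⟨N, hN, hs⟩ := Nominal.finite_support (𝒩 := 𝒩) φ
    exact ⟨N, hN, fun σ hσ => (hs σ fun a ha => hσ a ha).symm⟩)

theorem NTS.alphaEq_act_congr {α : Act} {R S : Raw Pred Act κ} (h : T.AlphaEq R S) :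
    T.AlphaEq (Raw.act α R) (Raw.act α S) :=
  T.alphaEq_act.2 ⟨1, one_smul _ _, by rwa [inv_one, one_smul], fun a _ => one_smul _ a⟩

/-- The action modality; the binding names of `α` bind into `α` and `A`. -/
noncomputable def NTS.Formula.may (α : Act) (A : T.Formula κ) : T.Formula κ :=
  NTS.Formula.mk (Raw.act α A.rep) (by
    refine ⟨?_, A.rep_hfs⟩
    obtain ⟨N, hN, hs⟩ := Nominal.finite_support (𝒩 := 𝒩) α
    obtain ⟨M, hM, ht⟩ := A.rep_hfs.finSupp
    refine ⟨N ∪ M, hN.union hM, fun σ hσ => ?_⟩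
    rw [Raw.smul_act, hs σ fun a ha => hσ a (Or.inl ha)]
    exact NTS.alphaEq_act_congr (ht σ fun a ha => hσ a (Or.inr ha)))

theorem NTS.Formula.may_mk (α : Act) {R : Raw Pred Act κ} (h : T.HFS R)
    (h' : T.HFS (Raw.act α R)) :
    NTS.Formula.may α (NTS.Formula.mk R h) = NTS.Formula.mk (Raw.act α R) h' :=
  NTS.Formula.mk_eq_mk.2 (NTS.alphaEq_act_congr (NTS.Formula.rep_mk h))

theorem NTS.Formula.smul_may (π : NPerm 𝒩) (α : Act) (A : T.Formula κ) :
    π • NTS.Formula.may α A = NTS.Formula.may (π • α) (π • A) := by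
  exact (NTS.Formula.smul_mk _ _ _).trans (NTS.Formula.mk_eq_mk.2
    (NTS.alphaEq_act_congr (T.alphaEq_symm (NTS.Formula.rep_mk _))))

theorem NTS.Formula.smul_neg (π : NPerm 𝒩) (A : T.Formula κ) :
    π • NTS.Formula.neg A = NTS.Formula.neg (π • A) := by
  exact (NTS.Formula.smul_mk _ _ _).trans (NTS.Formula.mk_eq_mk.2
    (show T.AlphaEq _ _ from T.alphaEq_symm (NTS.Formula.rep_mk _)))

theorem finSuppFamily_of_common {I : Type w} {A : I → T.Formula κ} {N : Set 𝒩} (hN : N.Finite)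
    (h : ∀ i, MulAction.Supports (NPerm 𝒩) N (A i)) : FinSuppFamily A := by
  refine ⟨N, hN, fun σ hσ => ?_⟩
  rw [← Set.range_comp]
  congr 1
  funext i
  exact h i σ fun {a} ha => hσ a ha

/-- Binary conjunction. -/
noncomputable def NTS.Formula.and (hκ : ℵ₀ < κ) (A B : T.Formula κ) : T.Formula κ :=
  NTS.Formula.conj (ULift.{w} Bool) ((lt_aleph0_of_finite _).trans hκ)
    (fun i => if i.down then A else B) (by
      obtain ⟨N, hN, hs⟩ := Nominal.finite_support (𝒩 := 𝒩) A
      obtain ⟨M, hM, ht⟩ := Nominal.finite_support (𝒩 := 𝒩) B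
      refine finSuppFamily_of_common (hN.union hM) fun i σ hσ => ?_
      split
      · exact hs σ fun a ha => hσ (Or.inl ha)
      · exact ht σ fun a ha => hσ (Or.inr ha))

/-- Disjunction, the dual of conjunction. -/
noncomputable def NTS.Formula.disj (I : Type w) (hI : #I < κ) (A : I → T.Formula κ)
    (hA : FinSuppFamily fun i => (A i).neg) : T.Formula κ :=
  NTS.Formula.neg (NTS.Formula.conj I hI (fun i => (A i).neg) hA)

/-- The weak modality for the unobservable action `τ`: the disjunction over all `i` in `ω` of the
`i`-fold application of the action modality for `τ` to `A`. -/
noncomputable def NTS.Formula.wmayTau (hκ : ℵ₀ < κ) (τ : Act) (A : T.Formula κ) : T.Formula κ :=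
  NTS.Formula.disj (ULift.{w} ℕ) ((mk_le_aleph0).trans_lt hκ)
    (fun i => (NTS.Formula.may τ)^[i.down] A) (by
      obtain ⟨N, hN, hs⟩ := Nominal.finite_support (𝒩 := 𝒩) τ
      obtain ⟨M, hM, ht⟩ := Nominal.finite_support (𝒩 := 𝒩) A
      refine finSuppFamily_of_common (hN.union hM) fun i σ hσ => ?_
      rw [NTS.Formula.smul_neg]
      congr 1
      induction i.down with
      | zero => exact ht σ fun a ha => hσ (Or.inr ha)
      | succ n ih =>
        rw [Function.iterate_succ_apply', NTS.Formula.smul_may, ih,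
          hs σ fun a ha => hσ (Or.inl ha)])

open Classical in
/-- The weak action modality. -/
noncomputable def NTS.Formula.wmay (hκ : ℵ₀ < κ) (τ α : Act) (A : T.Formula κ) : T.Formula κ :=
  if α = τ then NTS.Formula.wmayTau hκ τ A
  else NTS.Formula.wmayTau hκ τ (NTS.Formula.may α (NTS.Formula.wmayTau hκ τ A))

/-- Weak formulas. -/
inductive IsWeak (hκ : ℵ₀ < κ) (τ : Act) : T.Formula κ → Prop
  | conj (I : Type w) (hI : #I < κ) (A : I → T.Formula κ) (hA : FinSuppFamily A)
      (h : ∀ i, IsWeak hκ τ (A i)) : IsWeak hκ τ (NTS.Formula.conj I hI A hA)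
  | neg (A : T.Formula κ) (h : IsWeak hκ τ A) : IsWeak hκ τ A.neg
  | wmay (α : Act) (A : T.Formula κ) (h : IsWeak hκ τ A) :
      IsWeak hκ τ (NTS.Formula.wmay hκ τ α A)
  | wmayPred (A : T.Formula κ) (φ : Pred) (h : IsWeak hκ τ A) :
      IsWeak hκ τ (NTS.Formula.wmay hκ τ τ (NTS.Formula.and hκ A (NTS.Formula.pred φ)))

/-! ### Validity -/

variable (T) in
/-- Validity of raw formulas.  In the last case `π` ranges over the permutations that turn
`α`, `R` into an alpha-variant `π • α`, `π • R`, the binding names of the variant are required to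
be fresh for `P`, and `RawValid R (π⁻¹ • P')` says that `π • R` is valid for `P'`. -/
def NTS.RawValid : Raw Pred Act κ → State → Prop
  | .conj _ _ f, P => ∀ i, NTS.RawValid (f i) P
  | .neg R, P => ¬ NTS.RawValid R P
  | .pred φ, P => T.Sat P φ
  | .act α R, P => ∃ π : NPerm 𝒩,
      (∀ a ∈ (supp 𝒩 α ∪ T.rsupp R) \ (T.bn α : Set 𝒩), π • a = a) ∧
      Fresh (T.bn (π • α)) P ∧
      ∃ P', T.Step P (π • α) P' ∧ NTS.RawValid R (π⁻¹ • P')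

theorem Fresh.smul {P : State} {B : Finset 𝒩} (h : Fresh B P) (ρ : NPerm 𝒩) :
    Fresh (permNames ρ B) (ρ • P) := fun _ ha hs =>
  h _ (mem_permNames.1 ha) (mem_supp_smul.1 hs)

theorem NTS.rawValid_act_smul {R : Raw Pred Act κ}
    (ih : ∀ (ρ : NPerm 𝒩) (P : State), T.RawValid (ρ • R) (ρ • P) ↔ T.RawValid R P)
    (α : Act) (ρ : NPerm 𝒩) (P : State) (h : T.RawValid (Raw.act α R) P) :
    T.RawValid (Raw.act (ρ • α) (ρ • R)) (ρ • P) := by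
  obtain ⟨π, h1, h2, P', h3, h4⟩ := h
  have e : (ρ * π * ρ⁻¹) • ρ • α = ρ • π • α := by
    rw [mul_smul, mul_smul, inv_smul_smul]
  refine ⟨ρ * π * ρ⁻¹, ?_, ?_, ρ • P', ?_, ?_⟩
  · rintro a ⟨ha, hab⟩
    have := h1 (ρ⁻¹ • a) ⟨ha.imp mem_supp_smul.1 T.mem_rsupp_smul.1,
      fun h => hab (T.mem_bn_smul.2 h)⟩
    rw [mul_smul, mul_smul, this, smul_inv_smul]
  · rw [e, T.bn_equivariant]
    exact h2.smul ρ
  · rw [e]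
    exact h3.smul ρ
  · rw [mul_inv_rev, mul_inv_rev, inv_inv, mul_smul, mul_smul, inv_smul_smul]
    exact (ih ρ _).2 h4

theorem NTS.rawValid_smul {R : Raw Pred Act κ} (ρ : NPerm 𝒩) (P : State) :
    T.RawValid (ρ • R) (ρ • P) ↔ T.RawValid R P := by
  induction R generalizing ρ P with
  | conj I hI f ih => exact forall_congr' fun i => ih i ρ P
  | neg R ih => exact not_congr (ih ρ P)
  | pred φ =>
    refine ⟨fun h => ?_, fun h => T.sat_equivariant ρ P φ h⟩
    have := T.sat_equivariant ρ⁻¹ _ _ (show T.Sat (ρ • P) (ρ • φ) from h)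
    rw [inv_smul_smul, inv_smul_smul] at this
    exact this
  | act α R ih =>
    refine ⟨fun h => ?_, fun h => NTS.rawValid_act_smul ih α ρ P h⟩
    have := NTS.rawValid_act_smul (R := ρ • R) (fun σ Q => by
      have h1 := ih (σ * ρ) (ρ⁻¹ • Q)
      have h2 := ih ρ (ρ⁻¹ • Q)
      rw [smul_inv_smul] at h2
      rw [mul_smul, mul_smul, smul_inv_smul] at h1
      exact h1.trans h2.symm) (ρ • α) ρ⁻¹ (ρ • P) h
    rwa [inv_smul_smul, inv_smul_smul, inv_smul_smul] at this

theorem NTS.rawValid_act_congr {α β : Act} {R S : Raw Pred Act κ} {ρ : NPerm 𝒩}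
    (hβ : ρ • α = β) (h : T.AlphaEq R (ρ⁻¹ • S))
    (hρ : ∀ a ∈ (supp 𝒩 α ∪ T.rsupp R) \ (T.bn α : Set 𝒩), ρ • a = a)
    (key : ∀ X : State, T.RawValid R X ↔ T.RawValid S (ρ • X)) (P : State)
    (hP : T.RawValid (Raw.act α R) P) : T.RawValid (Raw.act β S) P := by
  subst hβ
  obtain ⟨σ, h1, h2, P', h3, h4⟩ := hP
  have e : (σ * ρ⁻¹) • ρ • α = σ • α := by rw [mul_smul, inv_smul_smul]
  refine ⟨σ * ρ⁻¹, ?_, by rwa [e], P', by rwa [e], ?_⟩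
  · rintro a ⟨ha, hab⟩
    have hm : ρ⁻¹ • a ∈ (supp 𝒩 α ∪ T.rsupp R) \ (T.bn α : Set 𝒩) := by
      refine ⟨ha.imp mem_supp_smul.1 fun k => ?_, fun k => hab (T.mem_bn_smul.2 k)⟩
      rwa [T.rsupp_congr h, T.mem_rsupp_smul, inv_inv, smul_inv_smul]
    have h5 := hρ _ hm
    rw [mul_smul, h1 _ hm, ← h5, smul_inv_smul]
  · rw [mul_inv_rev, inv_inv, mul_smul]
    exact (key _).1 h4

theorem NTS.rawValid_congr {R S : Raw Pred Act κ} (h : T.AlphaEq R S) (P : State) :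
    T.RawValid R P ↔ T.RawValid S P := by
  induction R generalizing S P with
  | conj I hI f ih =>
    cases S with
    | conj J hJ g =>
      refine ⟨fun k j => ?_, fun k i => ?_⟩
      · obtain ⟨i, hi⟩ := h.2 j
        exact (ih i hi P).1 (k i)
      · obtain ⟨j, hj⟩ := h.1 i
        exact (ih i hj P).2 (k j)
    | _ => exact h.elim
  | neg R ih =>
    cases S with
    | neg S => exact not_congr (ih (S := S) h P)
    | _ => exact h.elim
  | pred φ =>
    cases S with
    | pred ψ => cases (show φ = ψ from h); exact Iff.rfl
    | _ => exact h.elim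
  | act α R ih =>
    cases S with
    | act β S =>
      refine ⟨?_, ?_⟩
      · obtain ⟨ρ, h1, h2, h3⟩ := T.alphaEq_act.1 h
        refine NTS.rawValid_act_congr h1 h2 h3 (fun X => ?_) P
        rw [ih h2 X, ← NTS.rawValid_smul ρ, smul_inv_smul]
      · obtain ⟨ρ, h1, h2, h3⟩ := T.alphaEq_act.1 (T.alphaEq_symm h)
        refine NTS.rawValid_act_congr h1 h2 h3 (fun X => ?_) P
        have h4 : T.AlphaEq R (ρ • S) := by
          have := T.alphaEq_smul (T.alphaEq_symm h2) ρ
          rwa [smul_inv_smul] at this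
        rw [ih h4, NTS.rawValid_smul]
    | _ => exact h.elim

/-- `Valid P A`: the formula `A` is valid for the state `P`. -/
def NTS.Formula.Valid (P : State) (A : T.Formula κ) : Prop :=
  Quotient.lift (s := T.rawSetoid κ) (fun R => T.RawValid R P)
    (fun _ _ h => propext (NTS.rawValid_congr h P)) A.1

theorem NTS.Formula.valid_mk {P : State} {R : Raw Pred Act κ} (h : T.HFS R) :
    (NTS.Formula.mk R h).Valid P ↔ T.RawValid R P := Iff.rfl

theorem NTS.Formula.valid_rep {P : State} (A : T.Formula κ) :
    T.RawValid A.rep P ↔ A.Valid P := by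
  conv_rhs => rw [← A.mk_rep]
  exact Iff.rfl

theorem NTS.Formula.valid_conj {P : State} {I : Type w} {hI : #I < κ} {A : I → T.Formula κ}
    {hA : FinSuppFamily A} : (NTS.Formula.conj I hI A hA).Valid P ↔ ∀ i, (A i).Valid P :=
  forall_congr' fun i => (A i).valid_rep

theorem NTS.Formula.valid_neg {P : State} {A : T.Formula κ} : A.neg.Valid P ↔ ¬ A.Valid P :=
  not_congr A.valid_rep

theorem NTS.Formula.valid_pred {P : State} {φ : Pred} :
    (NTS.Formula.pred φ : T.Formula κ).Valid P ↔ T.Sat P φ := Iff.rfl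

theorem NTS.Formula.valid_may {P : State} {α : Act} {A : T.Formula κ} :
    (NTS.Formula.may α A).Valid P ↔ ∃ (β : Act) (B : T.Formula κ),
      NTS.Formula.may β B = NTS.Formula.may α A ∧ Fresh (T.bn β) P ∧
      ∃ P', T.Step P β P' ∧ B.Valid P' := by
  constructor
  · rintro ⟨π, h1, h2, P', h3, h4⟩
    refine ⟨π • α, π • A, ?_, h2, P', h3, ?_⟩
    · refine (NTS.Formula.mk_eq_mk.2 ?_).symm
      refine T.alphaEq_act.2 ⟨π, rfl, ?_, h1⟩
      have := T.alphaEq_smul (NTS.Formula.rep_mk (A.rep_hfs.smul π)) π⁻¹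
      rw [inv_smul_smul] at this
      exact T.alphaEq_symm this
    · refine (NTS.rawValid_smul (T := T) π⁻¹ _).1 ?_
      rwa [inv_smul_smul]
  · rintro ⟨β, B, h, hf, P', h3, h4⟩
    refine (NTS.rawValid_congr (NTS.Formula.mk_eq_mk.1 h) P).1 ?_
    refine ⟨1, fun a _ => one_smul _ a, by rwa [one_smul], P', by rwa [one_smul], ?_⟩
    rw [inv_one, one_smul]
    exact B.valid_rep.2 h4

/-! ### Weak transitions, weak bisimilarity and weak logical equivalence -/

variable (T)

/-- `T.Silent τ P P'`: there are zero or more `τ`-transitions from `P` to `P'`. -/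
def NTS.Silent (τ : Act) : State → State → Prop :=
  Relation.ReflTransGen fun P P' => T.Step P τ P'

/-- A transition `α` preceded and followed by any number of `τ`-transitions. -/
def NTS.SilentStep (τ : Act) (P : State) (α : Act) (P' : State) : Prop :=
  ∃ P₁ P₂, T.Silent τ P P₁ ∧ T.Step P₁ α P₂ ∧ T.Silent τ P₂ P'

/-- Weak transitions. -/
def NTS.WeakStep (τ : Act) (P : State) (α : Act) (P' : State) : Prop :=
  (α = τ → T.Silent τ P P') ∧ (α ≠ τ → T.SilentStep τ P α P')

/-- `R` is a weak simulation. -/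
def NTS.IsWeakSimulation (τ : Act) (R : State → State → Prop) : Prop :=
  ∀ P Q, R P Q → ∀ (α : Act) (P' : State), Fresh (T.bn α) Q → T.Step P α P' →
    ∃ Q', T.WeakStep τ Q α Q' ∧ R P' Q'

/-- `R` is a weak static implication. -/
def NTS.IsWeakStaticImplication (τ : Act) (R : State → State → Prop) : Prop :=
  ∀ P Q, R P Q → ∀ φ : Pred, T.Sat P φ → ∃ Q', T.Silent τ Q Q' ∧ T.Sat Q' φ ∧ R P Q'

/-- `R` is a weak bisimulation. -/
def NTS.IsWeakBisimulation (τ : Act) (R : State → State → Prop) : Prop :=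
  (∀ P Q, R P Q → R Q P) ∧ T.IsWeakSimulation τ R ∧ T.IsWeakStaticImplication τ R

/-- Weak bisimilarity. -/
def NTS.WeaklyBisimilar (τ : Act) (P Q : State) : Prop :=
  ∃ R : State → State → Prop, T.IsWeakBisimulation τ R ∧ R P Q

/-- Weak logical equivalence: the two states satisfy the same weak formulas. -/
def NTS.WeaklyLogicallyEquivalent (hκ : ℵ₀ < κ) (τ : Act) (P Q : State) : Prop :=
  ∀ A : T.Formula κ, IsWeak hκ τ A → (A.Valid P ↔ A.Valid Q)

end Logic

/-! ### Renaming names by finite sort-preserving permutations -/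

section Permutations

variable {𝒩 : Type u} [SortedNames 𝒩]

/-! Logical equivalence is itself a weak bisimulation. The Hennessy-Milner argument would combine,
for a state `P`, one formula separating `P` from each inequivalent state into a single conjunction.
Such a conjunction must be finitely supported, and arbitrary separating formulas have no common
finite support. `NTS.exists_distinguishing` repairs this: a separating formula is replaced by the
conjunction of its orbit under the permutations fixing `supp 𝒩 P` pointwise. This keeps it valid at
`P`, keeps it false at the other state, and confines its support to that of `P`. The orbit is
countable because there are only countably many permutations. As κ exceeds the number of states, all
these formulas can be conjoined into a characteristic formula of `P` (`NTS.exists_characteristic`),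
supported by `supp 𝒩 P`.

For simulation, let `P` go to `P'` by `α` and let `A` be characteristic for `P'`. Then `⟨⟨α⟩⟩A`
holds at `P` (`NTS.Formula.valid_wmay_of_step`), hence at `Q`, and it yields a weak transition to a
state satisfying `A`, hence equivalent to `P'` (`NTS.exists_weakStep_of_valid_wmay`). The work lies
in the bound names: the formula only promises a transition for some alpha-variant of `α`, and it
must be renamed back to `α` itself. For static implication, `⟨⟨τ⟩⟩(A ∧ φ)` is used with `A`
characteristic for `P`. -/

theorem NPerm.finite_moved (π : NPerm 𝒩) : {a : 𝒩 | π • a ≠ a}.Finite := π.2.1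

theorem NPerm.sort_smul (π : NPerm 𝒩) (a : 𝒩) :
    SortedNames.sort (π • a) = SortedNames.sort a := π.2.2 a

/-- The transposition of two names of the same sort. -/
theorem NPerm.exists_swap {a b : 𝒩} (h : SortedNames.sort a = SortedNames.sort b) :
    ∃ π : NPerm 𝒩, π • a = b ∧ ∀ c, c ≠ a → c ≠ b → π • c = c := by
  classical
  refine ⟨⟨Equiv.swap a b, ?_, fun c => ?_⟩, Equiv.swap_apply_left a b,
    fun c h1 h2 => Equiv.swap_apply_of_ne_of_ne h1 h2⟩
  · refine (Set.toFinite {a, b}).subset fun c hc => ?_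
    by_contra h'
    simp only [Set.mem_insert_iff, Set.mem_singleton_iff, not_or] at h'
    exact hc (Equiv.swap_apply_of_ne_of_ne h'.1 h'.2)
  · rw [Equiv.swap_apply_def]
    split_ifs with h1 h2
    · rw [h1, h]
    · rw [h2, h]
    · rfl

/-- The names in `B` can be renamed apart from a finite set `C` without touching the other names
in `C`. -/
theorem NPerm.exists_fresh (B : Finset 𝒩) {C : Set 𝒩} (hC : C.Finite) :
    ∃ π : NPerm 𝒩, (∀ a ∈ B, π • a ∉ C) ∧ ∀ a ∈ C, a ∉ B → π • a = a := by
  classical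
  induction B using Finset.induction_on generalizing C with
  | empty => exact ⟨1, by simp, fun a _ _ => one_smul _ a⟩
  | insert b B hb ih =>
    -- Adding `b` to the avoided set makes `π` fix `b` and keep the images of `B` away from `b`, so
    -- the later swap of `b` with `c` does not disturb them.
    obtain ⟨π, h1, h2⟩ := ih (hC.insert b)
    obtain ⟨c, hc, hcC⟩ := (SortedNames.infinite_sort b).exists_notMem_finite
      ((hC.insert b).union (B.finite_toSet.image fun a => π • a))
    simp only [Set.mem_union, Set.mem_insert_iff, not_or] at hcC
    obtain ⟨σ, k1, k2⟩ := NPerm.exists_swap (Eq.symm hc : SortedNames.sort b = SortedNames.sort c)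
    have hπb : π • b = b := h2 b (Set.mem_insert _ _) hb
    refine ⟨σ * π, fun a ha => ?_, fun a ha hab => ?_⟩
    · rw [mul_smul]
      rcases Finset.mem_insert.1 ha with rfl | ha
      · rw [hπb, k1]
        exact hcC.1.2
      · have h3 := h1 a ha
        rw [Set.mem_insert_iff, not_or] at h3
        rw [k2 _ h3.1 fun h => hcC.2 ⟨a, ha, h⟩]
        exact h3.2
    · rw [Finset.mem_insert, not_or] at hab
      rw [mul_smul, h2 a (Set.mem_insert_of_mem _ ha) hab.2]
      exact k2 a hab.1 fun h => hcC.1.2 (h ▸ ha)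

/-- A permutation that takes `B` to a disjoint set agrees on `B` with a permutation that leaves
all names outside these two sets invariant. -/
theorem NPerm.exists_eqOn (σ : NPerm 𝒩) (B : Finset 𝒩) (hB : ∀ a ∈ B, σ • a ∉ B) :
    ∃ π : NPerm 𝒩, (∀ a ∈ B, π • a = σ • a) ∧
      ∀ a, a ∉ B → a ∉ permNames σ B → π • a = a := by
  classical
  -- Exchange `B` with its image along `σ`. Since the two sets are disjoint this is an involution,
  -- hence a bijection.
  let f : 𝒩 → 𝒩 := fun a => if a ∈ B then σ • a else if a ∈ permNames σ B then σ⁻¹ • a else a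
  have f1 : ∀ a ∈ B, f a = σ • a := fun a ha => if_pos ha
  have f2 : ∀ a ∈ permNames σ B, f a = σ⁻¹ • a := fun a ha => by
    have h : a ∉ B := fun h => hB _ (mem_permNames.1 ha) (by rwa [smul_inv_smul])
    simp only [f, if_neg h, if_pos ha]
  have f3 : ∀ a, a ∉ B → a ∉ permNames σ B → f a = a := fun a h1 h2 => by
    simp only [f, if_neg h1, if_neg h2]
  have hf : Function.Involutive f := fun a => by
    by_cases h1 : a ∈ B
    · rw [f1 a h1, f2 _ (mem_permNames.2 (by rwa [inv_smul_smul])), inv_smul_smul]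
    · by_cases h2 : a ∈ permNames σ B
      · rw [f2 a h2, f1 _ (mem_permNames.1 h2), smul_inv_smul]
      · rw [f3 a h1 h2, f3 a h1 h2]
  refine ⟨⟨hf.toPerm, ?_, fun a => ?_⟩, f1, f3⟩
  · refine (B ∪ permNames σ B).finite_toSet.subset fun a ha => ?_
    by_contra h
    rw [Finset.mem_coe, Finset.mem_union, not_or] at h
    exact ha (f3 a h.1 h.2)
  · change SortedNames.sort (f a) = _
    by_cases h1 : a ∈ B
    · rw [f1 a h1, NPerm.sort_smul]
    · by_cases h2 : a ∈ permNames σ B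
      · rw [f2 a h2, NPerm.sort_smul]
      · rw [f3 a h1 h2]

/-- A permutation is determined by its graph on the finitely many names it moves, and finite subsets
of a countable set are countable. This makes orbits of formulas small enough to be conjoined. -/
instance NPerm.instCountable : Countable (NPerm 𝒩) := by
  have : Countable 𝒩 := SortedNames.countable
  let g : NPerm 𝒩 → Finset (𝒩 × 𝒩) := fun π =>
    (π.finite_moved.image fun a => (a, π • a)).toFinset
  have hg : ∀ π a b, (a, b) ∈ g π ↔ π • a ≠ a ∧ π • a = b := fun π a b => by
    simp only [g, Set.Finite.mem_toFinset, Set.mem_image, Set.mem_ofPred_eq, Prod.mk.injEq]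
    constructor
    · rintro ⟨c, h1, rfl, h2⟩
      exact ⟨h1, h2⟩
    · rintro ⟨h1, h2⟩
      exact ⟨a, h1, rfl, h2⟩
  refine Function.Injective.countable (f := g) fun π ρ h => ?_
  refine Subtype.ext (Equiv.ext fun a => ?_)
  change π • a = ρ • a
  by_cases h1 : π • a = a
  · by_cases h2 : ρ • a = a
    · rw [h1, h2]
    · exact ((hg π a _).1 (h ▸ (hg ρ a _).2 ⟨h2, rfl⟩)).2
  · exact ((hg ρ a _).1 (h ▸ (hg π a _).2 ⟨h1, rfl⟩)).2.symm

end Permutations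

/-! ### Existence of least supports -/

section Support

variable {𝒩 : Type u} [SortedNames 𝒩] {X : Type*}

/-- Let `σ` fix `A ∩ B`. A permutation `ρ` that fixes `A` fixes `x`, so the image of `B` under `ρ`
still supports `x`. Choosing `ρ` to push `B \ A` off the names moved by `σ` makes `σ` fix that whole
image. -/
theorem supports_inter [MulAction (NPerm 𝒩) X] {A B : Set 𝒩} {x : X} (hA : A.Finite)
    (hB : B.Finite) (hAx : MulAction.Supports (NPerm 𝒩) A x)
    (hBx : MulAction.Supports (NPerm 𝒩) B x) : MulAction.Supports (NPerm 𝒩) (A ∩ B) x := by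
  intro σ hσ
  obtain ⟨ρ, h1, h2⟩ := NPerm.exists_fresh (hB.sdiff (t := A)).toFinset (hA.union σ.finite_moved)
  simp only [Set.Finite.mem_toFinset, Set.mem_union, Set.mem_sdiff, not_or] at h1 h2
  have hρA : ∀ a ∈ A, ρ • a = a := fun a ha => h2 a (Or.inl ha) fun h => h.2 ha
  have h3 := supports_smul hBx ρ
  rw [hAx ρ fun a ha => hρA a ha] at h3
  refine h3 σ ?_
  rintro _ ⟨b, hb, rfl⟩
  by_cases hbA : b ∈ A
  · simp only [hρA b hbA]
    exact hσ ⟨hbA, hb⟩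
  · by_contra h
    exact (h1 b ⟨hb, hbA⟩).2 h

/-- An intersection of supporting sets need not obviously support anything. A supporting set of
least cardinality does, and it lies in every other finite supporting set, since intersecting the two
cannot make it smaller. -/
theorem finite_supp_and_supports [Nominal 𝒩 X] (x : X) :
    (supp 𝒩 x).Finite ∧ MulAction.Supports (NPerm 𝒩) (supp 𝒩 x) x := by
  classical
  have hex : ∃ n : ℕ, ∃ A : Set 𝒩, A.Finite ∧ MulAction.Supports (NPerm 𝒩) A x ∧ A.ncard = n := by
    obtain ⟨A, hA, hx⟩ := Nominal.finite_support (𝒩 := 𝒩) x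
    exact ⟨_, A, hA, hx, rfl⟩
  obtain ⟨A, hA, hx, hn⟩ := Nat.find_spec hex
  have : supp 𝒩 x = A := by
    refine Set.Subset.antisymm (Set.sInter_subset_of_mem ⟨hA, hx⟩) ?_
    refine Set.subset_sInter ?_
    rintro B ⟨hB, hBx⟩
    have h1 := Nat.find_min' hex ⟨A ∩ B, hA.subset Set.inter_subset_left,
      supports_inter hA hB hx hBx, rfl⟩
    rw [← hn] at h1
    rw [← Set.eq_of_subset_of_ncard_le Set.inter_subset_left h1 hA]
    exact Set.inter_subset_right
  rw [this]
  exact ⟨hA, hx⟩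

theorem finite_supp [Nominal 𝒩 X] (x : X) : (supp 𝒩 x).Finite := (finite_supp_and_supports x).1

theorem smul_eq_of_supp [Nominal 𝒩 X] {x : X} {π : NPerm 𝒩}
    (h : ∀ a ∈ supp 𝒩 x, π • a = a) : π • x = x :=
  (finite_supp_and_supports x).2 π fun {a} ha => h a ha

theorem supp_subset [SMul (NPerm 𝒩) X] {x : X} {A : Set 𝒩} (hA : A.Finite)
    (h : ∀ σ : NPerm 𝒩, (∀ a ∈ A, σ • a = a) → σ • x = x) : supp 𝒩 x ⊆ A :=
  Set.sInter_subset_of_mem ⟨hA, fun σ hσ => h σ fun _ ha => hσ ha⟩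

theorem supp_prod_subset {Y : Type*} [Nominal 𝒩 X] [Nominal 𝒩 Y] (x : X) (y : Y) :
    supp 𝒩 (x, y) ⊆ supp 𝒩 x ∪ supp 𝒩 y :=
  supp_subset ((finite_supp x).union (finite_supp y)) fun _ hσ =>
    Prod.ext (smul_eq_of_supp fun a ha => hσ a (Or.inl ha))
      (smul_eq_of_supp fun a ha => hσ a (Or.inr ha))

theorem smul_eq_of_supp_eq_empty [Nominal 𝒩 X] {x : X} (hx : supp 𝒩 x = ∅) (π : NPerm 𝒩) :
    π • x = x :=
  smul_eq_of_supp fun a ha => by simp [hx] at ha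

end Support

/-! ### Weak formulas and their validity -/

section WeakLogic

variable {𝒩 : Type u} [SortedNames 𝒩] {State Pred Act : Type*}
  [Nominal 𝒩 State] [Nominal 𝒩 Pred] [Nominal 𝒩 Act] {T : NTS 𝒩 State Pred Act}
  {κ : Cardinal.{w}}

/-! ### Equivariance of the derived constructors -/

/-- Lets the side conditions on `rsupp` in raw validity be read as conditions on the nominal support
of formulas. -/
theorem NTS.Formula.rsupp_rep (A : T.Formula κ) : T.rsupp A.rep = supp 𝒩 A := by
  have h : ∀ σ : NPerm 𝒩, T.AlphaEq A.rep (σ • A.rep) ↔ σ • A = A := fun σ => by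
    conv_rhs => rw [← A.mk_rep, NTS.Formula.smul_mk, NTS.Formula.mk_eq_mk]
    exact ⟨T.alphaEq_symm, T.alphaEq_symm⟩
  unfold NTS.rsupp suppOf supp
  simp only [h]
  rfl

theorem NTS.Formula.conj_congr {I : Type w} {hI : #I < κ} {A B : I → T.Formula κ}
    {hA : FinSuppFamily A} (hB : FinSuppFamily B) (h : A = B) :
    NTS.Formula.conj I hI A hA = NTS.Formula.conj I hI B hB := by
  subst h; rfl

theorem NTS.Formula.smul_rep_alphaEq (π : NPerm 𝒩) (A : T.Formula κ) :
    T.AlphaEq (π • A.rep) (π • A).rep :=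
  T.alphaEq_symm (NTS.Formula.rep_mk (A.rep_hfs.smul π))

theorem FinSuppFamily.smul {I : Type w} {A : I → T.Formula κ} (hA : FinSuppFamily A)
    (π : NPerm 𝒩) : FinSuppFamily fun i => π • A i := by
  obtain ⟨N, hN, hs⟩ := hA
  refine ⟨(fun a => π • a) '' N, hN.image _, fun σ hσ => ?_⟩
  have h1 := hs (π⁻¹ * σ * π) fun a ha => by
    rw [mul_smul, mul_smul, hσ _ (Set.mem_image_of_mem _ ha), inv_smul_smul]
  have h2 : (Set.range fun i => π • A i) = (fun B => π • B) '' Set.range A := Set.range_comp _ _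
  rw [h2]
  conv_rhs => rw [← h1]
  simp only [Set.image_image, mul_smul, smul_inv_smul]

theorem NTS.Formula.smul_conj (π : NPerm 𝒩) {I : Type w} {hI : #I < κ} {A : I → T.Formula κ}
    {hA : FinSuppFamily A} : π • NTS.Formula.conj I hI A hA =
      NTS.Formula.conj I hI (fun i => π • A i) (hA.smul π) :=
  (NTS.Formula.smul_mk _ _ _).trans (NTS.Formula.mk_eq_mk.2
    ⟨fun i => ⟨i, NTS.Formula.smul_rep_alphaEq π _⟩,
      fun i => ⟨i, NTS.Formula.smul_rep_alphaEq π _⟩⟩)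

theorem NTS.Formula.smul_pred (π : NPerm 𝒩) (φ : Pred) :
    π • (NTS.Formula.pred φ : T.Formula κ) = NTS.Formula.pred (π • φ) :=
  NTS.Formula.smul_mk _ _ _

theorem NTS.Formula.smul_and (hκ : ℵ₀ < κ) (π : NPerm 𝒩) (A B : T.Formula κ) :
    π • NTS.Formula.and hκ A B = NTS.Formula.and hκ (π • A) (π • B) := by
  refine (NTS.Formula.smul_conj π).trans (NTS.Formula.conj_congr _ (funext fun i => ?_))
  split <;> rfl

theorem NTS.Formula.smul_wmayTau (hκ : ℵ₀ < κ) {τ : Act} (hτ : supp 𝒩 τ = ∅) (π : NPerm 𝒩)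
    (A : T.Formula κ) :
    π • NTS.Formula.wmayTau hκ τ A = NTS.Formula.wmayTau hκ τ (π • A) := by
  refine (NTS.Formula.smul_neg π _).trans (congrArg NTS.Formula.neg
    ((NTS.Formula.smul_conj π).trans (NTS.Formula.conj_congr _ (funext fun i => ?_))))
  simp only [NTS.Formula.smul_neg]
  congr 1
  induction i.down with
  | zero => rfl
  | succ n ih =>
    rw [Function.iterate_succ_apply', Function.iterate_succ_apply', NTS.Formula.smul_may, ih,
      smul_eq_of_supp_eq_empty hτ]

theorem NTS.Formula.smul_wmay (hκ : ℵ₀ < κ) {τ : Act} (hτ : supp 𝒩 τ = ∅) (π : NPerm 𝒩)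
    (α : Act) (A : T.Formula κ) :
    π • NTS.Formula.wmay hκ τ α A = NTS.Formula.wmay hκ τ (π • α) (π • A) := by
  have h : π • α = τ ↔ α = τ := by
    rw [← eq_inv_smul_iff, smul_eq_of_supp_eq_empty hτ]
  unfold NTS.Formula.wmay
  by_cases hα : α = τ
  · rw [if_pos hα, if_pos (h.2 hα)]
    exact NTS.Formula.smul_wmayTau hκ hτ π A
  · rw [if_neg hα, if_neg (mt h.1 hα)]
    rw [NTS.Formula.smul_wmayTau hκ hτ, NTS.Formula.smul_may, NTS.Formula.smul_wmayTau hκ hτ]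

/-- Needed for conjoining an orbit of weak formulas. It depends on `τ` being invariant: otherwise a
permutation would turn the weak modalities into those of another silent action. -/
theorem IsWeak.smul {hκ : ℵ₀ < κ} {τ : Act} (hτ : supp 𝒩 τ = ∅) {A : T.Formula κ}
    (h : IsWeak hκ τ A) (π : NPerm 𝒩) : IsWeak hκ τ (π • A) := by
  induction h with
  | conj I hI A hA _ ih =>
    rw [NTS.Formula.smul_conj]
    exact .conj _ _ _ _ ih
  | neg A _ ih =>
    rw [NTS.Formula.smul_neg]
    exact .neg _ ih
  | wmay α A _ ih =>
    rw [NTS.Formula.smul_wmay hκ hτ]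
    exact .wmay _ _ ih
  | wmayPred A φ _ ih =>
    rw [NTS.Formula.smul_wmay hκ hτ, NTS.Formula.smul_and, NTS.Formula.smul_pred,
      smul_eq_of_supp_eq_empty hτ]
    exact .wmayPred _ _ ih

/-! ### Validity of the derived constructors -/

theorem NTS.Formula.valid_smul (π : NPerm 𝒩) (P : State) (A : T.Formula κ) :
    (π • A).Valid (π • P) ↔ A.Valid P :=
  (NTS.rawValid_smul π P).trans A.valid_rep

theorem NTS.Formula.valid_smul_iff (π : NPerm 𝒩) (P : State) (A : T.Formula κ) :
    (π • A).Valid P ↔ A.Valid (π⁻¹ • P) := by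
  rw [← NTS.Formula.valid_smul π (π⁻¹ • P), smul_inv_smul]

theorem NTS.Formula.valid_and {hκ : ℵ₀ < κ} {P : State} {A B : T.Formula κ} :
    (NTS.Formula.and hκ A B).Valid P ↔ A.Valid P ∧ B.Valid P := by
  refine NTS.Formula.valid_conj.trans ⟨fun h => ⟨h ⟨true⟩, h ⟨false⟩⟩, ?_⟩
  rintro ⟨h1, h2⟩ ⟨_ | _⟩
  exacts [h2, h1]

/-- Unlike `NTS.Formula.valid_may`, this form exhibits the alpha-variant by a permutation, which can
then be composed with other renamings. -/
theorem NTS.Formula.valid_may_iff {P : State} {α : Act} {A : T.Formula κ} :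
    (NTS.Formula.may α A).Valid P ↔ ∃ π : NPerm 𝒩,
      (∀ a ∈ (supp 𝒩 α ∪ supp 𝒩 A) \ (T.bn α : Set 𝒩), π • a = a) ∧
      Fresh (T.bn (π • α)) P ∧ ∃ P', T.Step P (π • α) P' ∧ (π • A).Valid P' := by
  simp only [NTS.Formula.valid_smul_iff, ← A.rsupp_rep, ← A.valid_rep]
  exact Iff.rfl

theorem NTS.bn_eq_empty {τ : Act} (hτ : supp 𝒩 τ = ∅) : T.bn τ = ∅ := by
  have := T.bn_subset τ
  rwa [hτ, Set.subset_empty_iff, Finset.coe_eq_empty] at this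

/-- As `τ` binds nothing, an alpha-converting permutation fixes the whole support of `A`, so
conversion is trivial and no freshness is required. -/
theorem NTS.Formula.valid_may_tau {τ : Act} (hτ : supp 𝒩 τ = ∅) {P : State} {A : T.Formula κ} :
    (NTS.Formula.may τ A).Valid P ↔ ∃ P', T.Step P τ P' ∧ A.Valid P' := by
  rw [NTS.Formula.valid_may_iff]
  constructor
  · rintro ⟨π, h1, -, P', h3, h4⟩
    rw [smul_eq_of_supp_eq_empty hτ] at h3
    rw [smul_eq_of_supp fun a ha => h1 a ⟨Or.inr ha, by simp [NTS.bn_eq_empty hτ]⟩] at h4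
    exact ⟨P', h3, h4⟩
  · rintro ⟨P', h1, h2⟩
    refine ⟨1, fun a _ => one_smul _ a, ?_, P', by rwa [one_smul], by rwa [one_smul]⟩
    simp [one_smul, NTS.bn_eq_empty hτ, Fresh]

theorem NTS.Formula.valid_wmayTau {hκ : ℵ₀ < κ} {τ : Act} (hτ : supp 𝒩 τ = ∅) {P : State}
    {A : T.Formula κ} :
    (NTS.Formula.wmayTau hκ τ A).Valid P ↔ ∃ P', T.Silent τ P P' ∧ A.Valid P' := by
  have h0 : (NTS.Formula.wmayTau hκ τ A).Valid P ↔
      ∃ n : ℕ, ((NTS.Formula.may τ)^[n] A).Valid P := by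
    refine NTS.Formula.valid_neg.trans ((not_congr NTS.Formula.valid_conj).trans ?_)
    simp only [NTS.Formula.valid_neg, not_forall, not_not]
    exact ⟨fun ⟨i, hi⟩ => ⟨_, hi⟩, fun ⟨n, hn⟩ => ⟨⟨n⟩, hn⟩⟩
  rw [h0]
  clear h0
  constructor
  · rintro ⟨n, hn⟩
    induction n generalizing P with
    | zero => exact ⟨P, .refl, hn⟩
    | succ n ih =>
      rw [Function.iterate_succ_apply', NTS.Formula.valid_may_tau hτ] at hn
      obtain ⟨P₁, h1, h2⟩ := hn
      obtain ⟨P', h3, h4⟩ := ih h2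
      exact ⟨P', .head h1 h3, h4⟩
  · rintro ⟨P', h1, h2⟩
    induction h1 using Relation.ReflTransGen.head_induction_on with
    | refl => exact ⟨0, h2⟩
    | head h _ ih =>
      obtain ⟨n, hn⟩ := ih
      refine ⟨n + 1, ?_⟩
      rw [Function.iterate_succ_apply', NTS.Formula.valid_may_tau hτ]
      exact ⟨_, h, hn⟩

/-! ### Weak modalities and weak transitions -/

theorem NTS.Silent.smul {τ : Act} (hτ : supp 𝒩 τ = ∅) {P P' : State} (h : T.Silent τ P P')
    (π : NPerm 𝒩) : T.Silent τ (π • P) (π • P') := by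
  refine Relation.ReflTransGen.lift (fun Q => π • Q) (fun Q Q' k => ?_) _ _ h
  have := NTS.Step.smul k π
  rwa [smul_eq_of_supp_eq_empty hτ] at this

/-- Alpha-conversion of transitions. -/
theorem NTS.Step.smul_residual {P : State} {α : Act} {P' : State} (h : T.Step P α P')
    {π : NPerm 𝒩} (hπ : ∀ a ∈ (supp 𝒩 α ∪ supp 𝒩 P') \ (T.bn α : Set 𝒩), π • a = a) :
    T.Step P (π • α) (π • P') := by
  have : NameAbs.mk (T.bn (π • α)) (π • α, π • P') = NameAbs.mk (T.bn α) (α, P') :=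
    Quotient.sound ((absSetoid 𝒩 (Act × State)).symm ⟨π, (T.bn_equivariant π α).symm, rfl,
      fun a ha => hπ a ⟨supp_prod_subset _ _ ha.1, ha.2⟩⟩)
  unfold NTS.Step
  rwa [this]

/-- The binding names of `α` may clash with `P`, so transition and formula must be alpha-converted
by the same permutation. The bound on `supp 𝒩 A` ensures that a permutation fixing the free names of
the residual also fixes those of the formula. -/
theorem NTS.Formula.valid_wmay_of_step {hκ : ℵ₀ < κ} {τ : Act} (hτ : supp 𝒩 τ = ∅)
    {P P' : State} {α : Act} {A : T.Formula κ} (h : T.Step P α P') (hA : A.Valid P')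
    (hs : supp 𝒩 A ⊆ supp 𝒩 P') : (NTS.Formula.wmay hκ τ α A).Valid P := by
  unfold NTS.Formula.wmay
  split_ifs with hα
  · subst hα
    exact (NTS.Formula.valid_wmayTau hτ).2 ⟨P', .single h, hA⟩
  rw [NTS.Formula.valid_wmayTau hτ]
  refine ⟨P, .refl, ?_⟩
  set B := NTS.Formula.wmayTau hκ τ A
  have hB : B.Valid P' := (NTS.Formula.valid_wmayTau hτ).2 ⟨P', .refl, hA⟩
  have hsB : supp 𝒩 B ⊆ supp 𝒩 P' := by
    refine supp_subset (finite_supp P') fun σ hσ => ?_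
    rw [NTS.Formula.smul_wmayTau hκ hτ, smul_eq_of_supp fun a ha => hσ a (hs ha)]
  obtain ⟨π, h1, h2⟩ := NPerm.exists_fresh (T.bn α)
    (((finite_supp α).union (finite_supp P')).union (finite_supp P))
  have h3 : ∀ a ∈ (supp 𝒩 α ∪ supp 𝒩 P') \ (T.bn α : Set 𝒩), π • a = a :=
    fun a ha => h2 a (Or.inl ha.1) ha.2
  refine NTS.Formula.valid_may_iff.2 ⟨π, fun a ha => h3 a ⟨ha.1.imp id fun k => hsB k, ha.2⟩, ?_,
    π • P', h.smul_residual h3, (NTS.Formula.valid_smul _ _ _).2 hB⟩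
  intro a ha hP
  rw [T.mem_bn_smul] at ha
  have := h1 _ ha
  rw [smul_inv_smul] at this
  exact this (Or.inr hP)

/-- The binding names of `α` are fresh for `Q`, but perhaps not for the state `Q₁` reached silently
before the visible step. Alpha-converting that step alone may therefore fail to restore the label
`α`. Instead the whole path from `Q` is permuted by some `σ⁻¹` that fixes `Q` and returns the label
to `α`. -/
theorem NTS.exists_weakStep_of_valid_wmay {hκ : ℵ₀ < κ} {τ : Act} (hτ : supp 𝒩 τ = ∅)
    {Q : State} {α : Act} {A : T.Formula κ} (hQ : Fresh (T.bn α) Q)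
    (h : (NTS.Formula.wmay hκ τ α A).Valid Q) : ∃ Q', T.WeakStep τ Q α Q' ∧ A.Valid Q' := by
  unfold NTS.Formula.wmay at h
  split_ifs at h with hα
  · obtain ⟨Q', h1, h2⟩ := (NTS.Formula.valid_wmayTau hτ).1 h
    exact ⟨Q', ⟨fun _ => h1, fun k => (k hα).elim⟩, h2⟩
  obtain ⟨Q₁, h1, h2⟩ := (NTS.Formula.valid_wmayTau hτ).1 h
  set B := NTS.Formula.wmayTau hκ τ A
  obtain ⟨π, hπ, hf, Q₂, h3, h4⟩ := NTS.Formula.valid_may_iff.1 h2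
  -- The binding names of `π • α` are fresh for `Q₁` but may meet `Q` or the binding names of `α`. A
  -- second renaming, which still fixes `Q₁`, moves them clear of everything.
  obtain ⟨ρ, r1, r2⟩ := NPerm.exists_fresh (T.bn (π • α))
    ((((finite_supp α).union (finite_supp B)).union (finite_supp Q)).union (finite_supp Q₁))
  have hρQ : ρ • Q₁ = Q₁ := smul_eq_of_supp fun a ha => r2 a (Or.inr ha) fun k => hf a k ha
  have hfresh : ∀ a ∈ T.bn α, (ρ * π) • a ∉ ((supp 𝒩 α ∪ supp 𝒩 B) ∪ supp 𝒩 Q) ∪ supp 𝒩 Q₁ :=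
    fun a ha => by
      rw [mul_smul]
      exact r1 _ (T.mem_bn_smul.2 (by rwa [inv_smul_smul]))
  have hfree : ∀ a ∈ (supp 𝒩 α ∪ supp 𝒩 B) \ (T.bn α : Set 𝒩), (ρ * π) • a = a := fun a ha => by
    rw [mul_smul, hπ a ha]
    refine r2 a (Or.inl (Or.inl ha.1)) fun k => ha.2 ?_
    have k1 := T.mem_bn_smul.1 k
    rwa [show π⁻¹ • a = a by rw [inv_smul_eq_iff, hπ a ha]] at k1
  -- `ρ * π` may move names of `Q`. Its replacement `σ` has the same effect on `α` and `B`, but only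
  -- exchanges two sets of names that are both fresh for `Q`.
  obtain ⟨σ, s1, s2⟩ := NPerm.exists_eqOn (ρ * π) (T.bn α) fun a ha k =>
    hfresh a ha (Or.inl (Or.inl (Or.inl (T.bn_subset α k))))
  have hσfix : ∀ a ∈ ((supp 𝒩 α ∪ supp 𝒩 B) ∪ supp 𝒩 Q) ∪ supp 𝒩 Q₁, a ∉ T.bn α → σ • a = a :=
    fun a ha hb => s2 a hb fun k => by
      have := hfresh _ (mem_permNames.1 k)
      rw [smul_inv_smul] at this
      exact this ha
  have hσQ : σ • Q = Q := smul_eq_of_supp fun a ha => hσfix a (Or.inl (Or.inr ha)) fun k => hQ a k ha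
  have hagree : ∀ a ∈ supp 𝒩 α ∪ supp 𝒩 B, σ • a = (ρ * π) • a := fun a ha => by
    by_cases hb : a ∈ T.bn α
    · exact s1 a hb
    · rw [hσfix a (Or.inl (Or.inl ha)) hb, hfree a ⟨ha, hb⟩]
  have hσα : σ⁻¹ • ρ • π • α = α := by
    rw [← mul_smul ρ, ← mul_smul]
    refine smul_eq_of_supp fun a ha => ?_
    rw [mul_smul, ← hagree a (Or.inl ha), inv_smul_smul]
  have hσB : σ⁻¹ • ρ • π • B = B := by
    rw [← mul_smul ρ, ← mul_smul]
    refine smul_eq_of_supp fun a ha => ?_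
    rw [mul_smul, ← hagree a (Or.inr ha), inv_smul_smul]
  have hB : B.Valid (σ⁻¹ • ρ • Q₂) := by
    rwa [← hσB, NTS.Formula.valid_smul, NTS.Formula.valid_smul]
  obtain ⟨Q', h5, h6⟩ := (NTS.Formula.valid_wmayTau hτ).1 hB
  refine ⟨Q', ⟨fun k => (hα k).elim, fun _ =>
    ⟨σ⁻¹ • Q₁, σ⁻¹ • ρ • Q₂, ?_, ?_, h5⟩⟩, h6⟩
  · have := h1.smul hτ σ⁻¹
    rwa [show σ⁻¹ • Q = Q by rw [inv_smul_eq_iff, hσQ]] at this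
  · have := (h3.smul ρ).smul σ⁻¹
    rwa [hρQ, hσα] at this

/-! ### Distinguishing formulas -/

/-- Conjoin the orbit of a separating formula under the pointwise stabiliser of `supp 𝒩 P`. The
stabiliser fixes `P`, so every conjunct holds at `P`. It maps the orbit to itself, which bounds the
support. The identity contributes the original formula, which fails at `Q`. -/
theorem NTS.exists_distinguishing {hκ : ℵ₀ < κ} {τ : Act} (hτ : supp 𝒩 τ = ∅) {P Q : State}
    (h : ¬ T.WeaklyLogicallyEquivalent hκ τ P Q) :
    ∃ A : T.Formula κ, IsWeak hκ τ A ∧ supp 𝒩 A ⊆ supp 𝒩 P ∧ A.Valid P ∧ ¬ A.Valid Q := by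
  obtain ⟨B, hB, hP, hQ⟩ : ∃ B : T.Formula κ, IsWeak hκ τ B ∧ B.Valid P ∧ ¬ B.Valid Q := by
    unfold NTS.WeaklyLogicallyEquivalent at h
    push Not at h
    obtain ⟨B, hB, ⟨hP, hQ⟩ | ⟨hP, hQ⟩⟩ := h
    · exact ⟨B, hB, hP, hQ⟩
    -- Closure under negation gives the separation the required direction.
    · exact ⟨B.neg, hB.neg, NTS.Formula.valid_neg.2 hP, fun k => NTS.Formula.valid_neg.1 k hQ⟩
  let G := {π : NPerm 𝒩 // ∀ a ∈ supp 𝒩 P, π • a = a}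
  have : Nonempty G := ⟨⟨1, fun a _ => one_smul _ a⟩⟩
  obtain ⟨g, hg⟩ := exists_surjective_nat G
  let A : ULift.{w} ℕ → T.Formula κ := fun i => (g i.down).1 • B
  have hmem : ∀ σ : NPerm 𝒩, (∀ a ∈ supp 𝒩 P, σ • a = a) → ∀ i, ∃ j, A j = σ • A i := by
    intro σ hσ i
    obtain ⟨n, hn⟩ := hg ⟨σ * (g i.down).1, fun a ha => by
      rw [mul_smul, (g i.down).2 a ha, hσ a ha]⟩
    exact ⟨⟨n⟩, by simp only [A, hn, mul_smul]⟩
  have himage : ∀ σ : NPerm 𝒩, (∀ a ∈ supp 𝒩 P, σ • a = a) →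
      (fun B => σ • B) '' Set.range A = Set.range A := by
    intro σ hσ
    refine Set.Subset.antisymm ?_ ?_
    · rintro _ ⟨_, ⟨i, rfl⟩, rfl⟩
      exact hmem σ hσ i
    · rintro _ ⟨i, rfl⟩
      obtain ⟨j, hj⟩ := hmem σ⁻¹ (fun a ha => by rw [inv_smul_eq_iff, hσ a ha]) i
      exact ⟨_, ⟨j, rfl⟩, by simp only [hj, smul_inv_smul]⟩
  have hA : FinSuppFamily A := ⟨supp 𝒩 P, finite_supp P, himage⟩
  refine ⟨NTS.Formula.conj _ (mk_le_aleph0.trans_lt hκ) A hA,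
    .conj _ _ _ _ fun i => hB.smul hτ _, ?_, ?_, ?_⟩
  · refine supp_subset (finite_supp P) fun σ hσ => ?_
    rw [NTS.Formula.smul_conj]
    -- `σ` permutes the conjuncts instead of fixing each one, so equality rests on conjunctions
    -- being compared as sets.
    refine NTS.Formula.mk_eq_mk.2 ⟨fun i => ?_, fun i => ?_⟩
    · obtain ⟨j, hj⟩ := hmem σ hσ i
      exact ⟨j, by simp only [hj]; exact T.alphaEq_refl _⟩
    · obtain ⟨j, hj⟩ := hmem σ⁻¹ (fun a ha => by rw [inv_smul_eq_iff, hσ a ha]) i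
      exact ⟨j, by simp only [hj, smul_inv_smul]; exact T.alphaEq_refl _⟩
  · refine NTS.Formula.valid_conj.2 fun i => ?_
    have := (NTS.Formula.valid_smul (g i.down).1 P B).2 hP
    rwa [smul_eq_of_supp (g i.down).2] at this
  · intro k
    obtain ⟨n, hn⟩ := hg ⟨1, fun a _ => one_smul _ a⟩
    have := NTS.Formula.valid_conj.1 k ⟨n⟩
    simp only [A, hn, one_smul] at this
    exact hQ this

end WeakLogic

/-! ### Characteristic formulas of states -/

section Characteristic

variable {𝒩 : Type u} [SortedNames 𝒩] {State : Type v} {Pred Act : Type*}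
  [Nominal 𝒩 State] [Nominal 𝒩 Pred] [Nominal 𝒩 Act] {T : NTS 𝒩 State Pred Act}
  {κ : Cardinal.{w}}

/-- A weak formula that separates `P` from all states that are not logically equivalent to it. -/
theorem NTS.exists_characteristic {hκ : ℵ₀ < κ} {τ : Act} (hτ : supp 𝒩 τ = ∅)
    (hκState : Cardinal.lift.{w} #State < Cardinal.lift.{v} κ) (P : State) :
    ∃ A : T.Formula κ, IsWeak hκ τ A ∧ supp 𝒩 A ⊆ supp 𝒩 P ∧ A.Valid P ∧
      ∀ Q, A.Valid Q → T.WeaklyLogicallyEquivalent hκ τ P Q := by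
  classical
  have key : ∀ Q, ∃ A : T.Formula κ, IsWeak hκ τ A ∧ supp 𝒩 A ⊆ supp 𝒩 P ∧ A.Valid P ∧
      (A.Valid Q → T.WeaklyLogicallyEquivalent hκ τ P Q) := by
    intro Q
    by_cases h : T.WeaklyLogicallyEquivalent hκ τ P Q
    -- The empty conjunction, valid everywhere, fills the places of equivalent states, so that the
    -- family can be indexed by all states.
    · refine ⟨NTS.Formula.conj PEmpty ((lt_aleph0_of_finite _).trans hκ) PEmpty.elim
        (finSuppFamily_of_common Set.finite_empty fun i => i.elim), .conj _ _ _ _ fun i => i.elim,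
        ?_, NTS.Formula.valid_conj.2 fun i => i.elim, fun _ => h⟩
      refine supp_subset (finite_supp P) fun σ _ => ?_
      rw [NTS.Formula.smul_conj]
      exact NTS.Formula.conj_congr _ (funext fun i => i.elim)
    · obtain ⟨A, h1, h2, h3, h4⟩ := NTS.exists_distinguishing hτ h
      exact ⟨A, h1, h2, h3, fun k => (h4 k).elim⟩
  choose A h1 h2 h3 h4 using key
  -- Conjunctions are indexed in `Type w`; the cardinal bound provides a copy `I` of `State` in that
  -- universe.
  obtain ⟨c, hc⟩ := Cardinal.mem_range_lift_of_le hκState.le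
  obtain ⟨I, rfl⟩ : ∃ I : Type w, #I = c := ⟨c.out, c.mk_out⟩
  obtain ⟨e⟩ := Cardinal.lift_mk_eq'.1 hc
  have hI : #I < κ := by rwa [← hc, Cardinal.lift_lt] at hκState
  have hfix : ∀ σ : NPerm 𝒩, (∀ a ∈ supp 𝒩 P, σ • a = a) → ∀ Q, σ • A Q = A Q :=
    fun σ hσ Q => smul_eq_of_supp fun a ha => hσ a (h2 Q ha)
  refine ⟨NTS.Formula.conj I hI (fun i => A (e i)) (finSuppFamily_of_common (finite_supp P)
    fun i σ hσ => hfix σ (fun a ha => hσ ha) _), .conj _ _ _ _ fun i => h1 _, ?_,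
    NTS.Formula.valid_conj.2 fun i => h3 _, fun Q hQ => h4 Q ?_⟩
  · refine supp_subset (finite_supp P) fun σ hσ => ?_
    rw [NTS.Formula.smul_conj]
    exact NTS.Formula.conj_congr _ (funext fun i => hfix σ hσ _)
  · have := NTS.Formula.valid_conj.1 hQ (e.symm Q)
    rwa [e.apply_symm_apply] at this

end Characteristic

/-! ### Logical equivalence as a weak bisimulation -/

theorem mainTheorem5 {𝒩 : Type u} [SortedNames 𝒩] {State : Type v} {Pred Act : Type*}
    [Nominal 𝒩 State] [Nominal 𝒩 Pred] [Nominal 𝒩 Act]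
    (T : NTS 𝒩 State Pred Act) (τ : Act) (hτ : supp 𝒩 τ = ∅)
    (κ : Cardinal.{w}) (hκ : ℵ₀ < κ) (hκState : Cardinal.lift.{w} #State < Cardinal.lift.{v} κ)
    (P Q : State) (h : T.WeaklyLogicallyEquivalent hκ τ P Q) :
    T.WeaklyBisimilar τ P Q := by
  refine ⟨T.WeaklyLogicallyEquivalent hκ τ, ⟨fun P Q h A hA => (h A hA).symm, ?_, ?_⟩, h⟩
  · intro P Q h α P' hα hP
    obtain ⟨A, h1, h2, h3, h4⟩ := T.exists_characteristic (hκ := hκ) hτ hκState P'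
    obtain ⟨Q', k1, k2⟩ := T.exists_weakStep_of_valid_wmay hτ hα
      ((h _ (.wmay α A h1)).1 (NTS.Formula.valid_wmay_of_step hτ hP h3 h2))
    exact ⟨Q', k1, h4 Q' k2⟩
  · intro P Q h φ hφ
    -- Here the characteristic formula is that of `P` itself: static implication requires the state
    -- reached from `Q` to remain related to `P` while satisfying `φ`.
    obtain ⟨A, h1, -, h3, h4⟩ := T.exists_characteristic (hκ := hκ) hτ hκState P
    have hv : ∀ X, (NTS.Formula.wmay hκ τ τ (NTS.Formula.and hκ A (.pred φ))).Valid X ↔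
        ∃ X', T.Silent τ X X' ∧ A.Valid X' ∧ T.Sat X' φ := fun X => by
      unfold NTS.Formula.wmay
      rw [if_pos rfl, NTS.Formula.valid_wmayTau hτ]
      simp only [NTS.Formula.valid_and, NTS.Formula.valid_pred]
    obtain ⟨Q', k1, k2, k3⟩ := (hv Q).1 ((h _ (.wmayPred A φ h1)).1
      ((hv P).2 ⟨P, .refl, h3, hφ⟩))
    exact ⟨Q', k1, k3, h4 Q' k2⟩
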